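/- Let $\varphi:[0,\infty)\to[0,\infty)$ be a convex $\varphi$-function, i.e. $\varphi$ is convex, continuous, nondecreasing, unbounded, and $\varphi(u)=0$ if and only if $u=0$. Assume that $\varphi$ satisfies the Orlicz condition $\varphi(u)/u\to\infty$ as $u\to\infty$. For real numbers $a<b$, let $L^\varphi[a,b]$ be the Orlicz space of all (Lebesgue) measurable $z:[a,b]\to\mathbb R$ such that $\int_a^b\varphi(|z(t)|/\lambda)\,dt<\infty$ for some $\lambda>0$. For $a<c$, let $GV_\varphi[a,c]$ be the space of all functions $x:[a,c]\to\mathbb R$ such that, for some $\lambda>0$, $$\sup_{\pi}\sum_{i=1}^m\varphi\!\left(\frac{|x(t_i)-x(t_{i-1})|}{\lambda\,(t_i-t_{i-1})}\right)(t_i-t_{i-1})<\infty,$$ the supremum being taken over all partitions $\pi: a=t_0<t_1<\dots<t_m=c$, $m\ge1$. Let $f:[a,b]\times\mathbb R\to\mathbb R$ satisfy the following two conditions: (C.1) for each $x\in\mathbb R$ the function $f(\cdot,x)$ is measurable on $[a,b]$, and there is $y_0\in\mathbb R$ such that $f(\cdot,y_0)\in L^\varphi[a,b]$; (C.2) there is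 a constant $L>0$ such that, for almost all $t\in[a,b]$, $|f(t,x)-f(t,y)|\le L|x-y|$ for all $x,y\in\mathbb R$. Then for every $x_0\in\mathbb R$ and every $b_1$ with $a<b_1\le b$ and $L(b_1-a)<1$, the initial value problem $$x'(t)=f(t,x(t))\ \text{ for almost all } t\in[a,b_1],\qquad x(a)=x_0,$$ has a solution $x\in GV_\varphi[a,b_1]$. -/

import Mathlib

open MeasureTheory Set Filter
open scoped ENNReal

noncomputable section

namespace GenVariation

/-- `φ` is a `φ`-function on `[0, ∞)`: it maps `[0, ∞)` to itself and is continuous, nondecreasing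
and unbounded there, and vanishes only at zero. Only the values on `[0, ∞)` matter. -/
structure IsPhiFunction (φ : ℝ → ℝ) : Prop where
  mapsTo : MapsTo φ (Ici 0) (Ici 0)
  continuousOn : ContinuousOn φ (Ici 0)
  monotoneOn : MonotoneOn φ (Ici 0)
  unbounded : ¬ BddAbove (φ '' Ici 0)
  eq_zero_iff : ∀ u, 0 ≤ u → (φ u = 0 ↔ u = 0)

/-- A convex `φ`-function on `[0, ∞)`. -/
structure IsConvexPhiFunction (φ : ℝ → ℝ) : Prop extends IsPhiFunction φ where
  convexOn : ConvexOn ℝ (Ici 0) φ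

/-- The Orlicz condition at infinity: `φ u / u → ∞` as `u → ∞`. -/
def OrliczCondition (φ : ℝ → ℝ) : Prop :=
  Tendsto (fun u => φ u / u) atTop atTop

/-- The Orlicz modular `∫_a^b φ(|z t|) dt`, with values in `[0, ∞]`. -/
def orliczModular (φ : ℝ → ℝ) (a b : ℝ) (z : ℝ → ℝ) : ℝ≥0∞ :=
  ∫⁻ t in Icc a b, ENNReal.ofReal (φ |z t|)

/-- Membership in the Orlicz space `L^φ[a, b]`: `z` is Lebesgue measurable on `[a, b]` and
`z / r` has finite Orlicz modular for some `r > 0`. -/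
def MemOrlicz (φ : ℝ → ℝ) (a b : ℝ) (z : ℝ → ℝ) : Prop :=
  AEMeasurable z (volume.restrict (Icc a b)) ∧
    ∃ r : ℝ, 0 < r ∧ orliczModular φ a b (fun t => z t / r) < ∞

/-- `a = t 0 < t 1 < ⋯ < t m = b`. -/
def IsPartition (a b : ℝ) (m : ℕ) (t : ℕ → ℝ) : Prop :=
  t 0 = a ∧ t m = b ∧ ∀ i < m, t i < t (i + 1)

/-- The modular `w_r(x, y)` on real functions on `[a, b]`: the supremum over all partitions of
`∑ φ(|(x(t_i) + y(t_{i-1})) - (x(t_{i-1}) + y(t_i))| / (r (t_i - t_{i-1}))) (t_i - t_{i-1})`. -/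
def varModular (φ : ℝ → ℝ) (a b r : ℝ) (x y : ℝ → ℝ) : ℝ≥0∞ :=
  ⨆ (m : ℕ) (t : ℕ → ℝ) (_ : IsPartition a b m t),
    ∑ i ∈ Finset.range m, ENNReal.ofReal
      (φ (|(x (t (i + 1)) + y (t i)) - (x (t i) + y (t (i + 1)))| / (r * (t (i + 1) - t i)))
        * (t (i + 1) - t i))

/-- Membership in `GV_φ[a, b]`, the space of functions of bounded generalized `φ`-variation:
`w_r(x, 0) < ∞` for some `r > 0`. Only the values of `x` on `[a, b]` matter. -/
def MemGV (φ : ℝ → ℝ) (a b : ℝ) (x : ℝ → ℝ) : Prop :=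
  ∃ r : ℝ, 0 < r ∧ varModular φ a b r x 0 < ∞

end GenVariation

end

open scoped Topology

namespace GenVariation

/-! Solve the integral equation by Banach's fixed point theorem, then read off the regularity of the
solution. In the sup norm the Picard operator has Lipschitz constant `L * (b₁ - a) < 1`; it is well
defined because `L^φ ⊆ L¹` and because `|f t (x t)| ≤ |f t y₀| + L * M` for bounded `x`. The same
bound puts `t ↦ f t (x t)` in `L^φ`, and Jensen's inequality on each partition interval
(`IsConvexPhiFunction.map_abs_integral_div_mul_le`) bounds the variation sums of its primitive by
the modular of the integrand. Lebesgue differentiation turns the integral equation into the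
differential one. -/

/-- Superposition of a Carathéodory function with a measurable function is measurable. -/
theorem aemeasurable_superposition {μ : Measure ℝ} {f : ℝ → ℝ → ℝ}
    (hmeas : ∀ x, AEMeasurable (fun t => f t x) μ) (hcont : ∀ᵐ t ∂μ, Continuous (f t))
    {g : ℝ → ℝ} (hg : Measurable g) : AEMeasurable (fun t => f t (g t)) μ := by
  have hlim : ∀ y : ℝ,
      Tendsto (fun n : ℕ => (⌊((n : ℝ) + 1) * y⌋ : ℝ) / ((n : ℝ) + 1)) atTop (𝓝 y) := by
    intro y
    have h1 : Tendsto (fun n : ℕ => y - 1 / ((n : ℝ) + 1)) atTop (𝓝 y) := by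
      simpa using tendsto_const_nhds.sub (tendsto_one_div_add_atTop_nhds_zero_nat (𝕜 := ℝ))
    refine tendsto_of_tendsto_of_tendsto_of_le_of_le h1 tendsto_const_nhds ?_ ?_
    · intro n
      have hn : (0 : ℝ) < (n : ℝ) + 1 := by positivity
      have := Int.lt_floor_add_one (((n : ℝ) + 1) * y)
      change y - 1 / ((n : ℝ) + 1) ≤ _
      rw [le_div_iff₀ hn, sub_mul, div_mul_cancel₀ _ hn.ne']
      linarith
    · intro n
      have hn : (0 : ℝ) < (n : ℝ) + 1 := by positivity
      have := Int.floor_le (((n : ℝ) + 1) * y)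
      change _ ≤ y
      rw [div_le_iff₀ hn]
      linarith
  -- Round `g` down to the grid of mesh `1 / (n + 1)`: the approximants take countably many values,
  -- and continuity of `f t` gives the limit.
  refine aemeasurable_of_tendsto_metrizable_ae'
    (f := fun (n : ℕ) t => f t ((⌊((n : ℝ) + 1) * g t⌋ : ℝ) / ((n : ℝ) + 1))) (fun n => ?_) ?_
  · have hF : Measurable (fun p : ℝ × ℤ => (hmeas ((p.2 : ℝ) / ((n : ℝ) + 1))).mk _ p.1) :=
      measurable_from_prod_countable_left fun k =>
        (hmeas ((k : ℝ) / ((n : ℝ) + 1))).measurable_mk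
    refine ⟨_, hF.comp (measurable_id.prodMk (hg.const_mul ((n : ℝ) + 1)).floor), ?_⟩
    -- Only countably many states occur, so the exceptional null sets have a null union.
    have hae : ∀ᵐ t ∂μ, ∀ k : ℤ, f t ((k : ℝ) / ((n : ℝ) + 1)) =
        (hmeas ((k : ℝ) / ((n : ℝ) + 1))).mk _ t := ae_all_iff.2 fun k => (hmeas _).ae_eq_mk
    filter_upwards [hae] with t ht
    exact ht _
  · filter_upwards [hcont] with t ht
    exact (ht.tendsto _).comp (hlim (g t))

/-- A `φ`-function composed with the absolute value is continuous. -/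
theorem IsPhiFunction.continuous_comp_abs {φ : ℝ → ℝ} (hφ : IsPhiFunction φ) :
    Continuous fun x => φ |x| :=
  hφ.continuousOn.comp_continuous continuous_abs fun x => abs_nonneg x

/-- Under the Orlicz condition `φ` dominates the identity up to a constant. -/
theorem OrliczCondition.exists_le_add {φ : ℝ → ℝ} (hO : OrliczCondition φ) (hφ : IsPhiFunction φ) :
    ∃ C : ℝ, ∀ u, 0 ≤ u → u ≤ φ u + C := by
  obtain ⟨u₀, h₀⟩ := eventually_atTop.1 (tendsto_atTop.1 hO 1)
  refine ⟨|u₀|, fun u hu => ?_⟩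
  have hφu : 0 ≤ φ u := hφ.mapsTo hu
  rcases le_or_gt u |u₀| with h | h
  · linarith
  · have h1 := h₀ u ((le_abs_self _).trans h.le)
    have hu0 : 0 < u := (abs_nonneg _).trans_lt h
    rw [le_div_iff₀ hu0] at h1
    linarith [abs_nonneg u₀]

/-- The composition `φ(|z| / r)` is integrable when its modular is finite. -/
theorem integrableOn_of_orliczModular_lt_top {φ : ℝ → ℝ} (hφ : IsPhiFunction φ) {a b : ℝ}
    {z : ℝ → ℝ} (hz : AEMeasurable z (volume.restrict (Icc a b)))
    (hfin : orliczModular φ a b z < ∞) : IntegrableOn (fun t => φ |z t|) (Icc a b) :=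
  ⟨(hφ.continuous_comp_abs.measurable.comp_aemeasurable hz).aestronglyMeasurable,
    (hasFiniteIntegral_iff_ofReal (.of_forall fun t => hφ.mapsTo (abs_nonneg (z t)))).2 hfin⟩

/-- Under the Orlicz condition `L^φ[a, b] ⊆ L¹[a, b]`. -/
theorem MemOrlicz.integrableOn {φ : ℝ → ℝ} (hO : OrliczCondition φ) (hφ : IsPhiFunction φ)
    {a b : ℝ} {z : ℝ → ℝ} (hz : MemOrlicz φ a b z) : IntegrableOn z (Icc a b) := by
  obtain ⟨hm, r, hr, hfin⟩ := hz
  obtain ⟨C, hC⟩ := hO.exists_le_add hφ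
  have hint := integrableOn_of_orliczModular_lt_top hφ (hm.div_const r) hfin
  have hdom : IntegrableOn (fun t => r * (φ |z t / r| + C)) (Icc a b) :=
    (hint.add (integrableOn_const (by simp))).const_mul r
  refine hdom.mono' hm.aestronglyMeasurable (.of_forall fun t => ?_)
  have h := hC |z t / r| (abs_nonneg _)
  rw [abs_div, abs_of_pos hr, div_le_iff₀ hr] at h
  rw [Real.norm_eq_abs, abs_div, abs_of_pos hr]
  linarith

/-- `L^φ[a, b]` is stable under perturbation by bounded functions. -/
theorem MemOrlicz.of_abs_le_add {φ : ℝ → ℝ} (hφ : IsPhiFunction φ) {a b : ℝ} {z w : ℝ → ℝ}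
    (hz : MemOrlicz φ a b z) (hw : AEMeasurable w (volume.restrict (Icc a b))) {M : ℝ}
    (h : ∀ᵐ t ∂(volume.restrict (Icc a b)), |w t| ≤ |z t| + M) : MemOrlicz φ a b w := by
  obtain ⟨hm, r, hr, hfin⟩ := hz
  -- With this scale, `|z t| ≤ r` forces `|w t| ≤ R`, and `|z t| ≥ r` forces `|w t| / R ≤ |z t| /
  -- r`; so `φ |w t / R|` is at most `φ 1` or `φ |z t / r|`, and no doubling condition on `φ` is
  -- needed.
  set R : ℝ := 2 * max r M with hR
  have hmax : 0 < max r M := lt_max_of_lt_left hr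
  have hR0 : 0 < R := by positivity
  have hint := integrableOn_of_orliczModular_lt_top hφ (hm.div_const r) hfin
  have hdom : IntegrableOn (fun t => φ |z t / r| + φ 1) (Icc a b) :=
    hint.add (integrableOn_const (by simp))
  refine ⟨hw, R, hR0, ?_⟩
  have hfin' : HasFiniteIntegral (fun t => φ |w t / R|) (volume.restrict (Icc a b)) := by
    refine hdom.hasFiniteIntegral.mono' ?_
    filter_upwards [h] with t ht
    have h0 : 0 ≤ φ |z t / r| := hφ.mapsTo (abs_nonneg (z t / r))
    have h1 : 0 ≤ φ 1 := hφ.mapsTo (mem_Ici.2 zero_le_one)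
    rw [Real.norm_of_nonneg (hφ.mapsTo (abs_nonneg (w t / R)))]
    rcases le_total |z t / r| 1 with hc | hc
    · have : |w t / R| ≤ 1 := by
        rw [abs_div, abs_of_pos hr, div_le_one hr] at hc
        rw [abs_div, abs_of_pos hR0, div_le_one hR0]
        linarith [le_max_left r M, le_max_right r M]
      linarith [hφ.monotoneOn (abs_nonneg (w t / R)) (mem_Ici.2 zero_le_one) this]
    · have : |w t / R| ≤ |z t / r| := by
        rw [abs_div (z t), abs_of_pos hr] at hc ⊢
        rw [abs_div (w t), abs_of_pos hR0, div_le_iff₀ hR0]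
        have h2 : |z t| = |z t| / r * r := (div_mul_cancel₀ _ hr.ne').symm
        have h3 : |z t| / r * r ≤ |z t| / r * max r M :=
          mul_le_mul_of_nonneg_left (le_max_left r M) (by positivity)
        have h4 : M ≤ |z t| / r * max r M :=
          (le_max_right r M).trans (le_mul_of_one_le_left hmax.le hc)
        rw [hR]
        linarith
      linarith [hφ.monotoneOn (abs_nonneg (w t / R)) (abs_nonneg (z t / r)) this]
  exact (hasFiniteIntegral_iff_ofReal
    (.of_forall fun t => hφ.mapsTo (abs_nonneg (w t / R)))).1 hfin'

/-- `MemOrlicz` restricts to subintervals with the same left endpoint. -/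
theorem MemOrlicz.mono_right {φ : ℝ → ℝ} {a b c : ℝ} {z : ℝ → ℝ} (hz : MemOrlicz φ a b z)
    (hcb : c ≤ b) : MemOrlicz φ a c z := by
  obtain ⟨hm, r, hr, hfin⟩ := hz
  have hsub : Icc a c ⊆ Icc a b := Icc_subset_Icc_right hcb
  exact ⟨hm.mono_set hsub, r, hr, (lintegral_mono_set hsub).trans_lt hfin⟩

/-- Jensen's inequality for the increment of an indefinite integral. -/
theorem IsConvexPhiFunction.map_abs_integral_div_mul_le {φ : ℝ → ℝ} (hφ : IsConvexPhiFunction φ)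
    {r s t : ℝ} (hr : 0 < r) (hst : s < t) {g : ℝ → ℝ} (hg : IntervalIntegrable g volume s t)
    (hφg : IntervalIntegrable (fun u => φ |g u / r|) volume s t) :
    φ (|∫ u in s..t, g u| / (r * (t - s))) * (t - s) ≤ ∫ u in s..t, φ |g u / r| := by
  have hts : 0 < t - s := sub_pos.2 hst
  have hg' : IntegrableOn (fun u => |g u / r|) (Ioc s t) :=
    (((intervalIntegrable_iff_integrableOn_Ioc_of_le hst.le).1 hg).div_const r).abs
  have hφg' : IntegrableOn (φ ∘ fun u => |g u / r|) (Ioc s t) :=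
    (intervalIntegrable_iff_integrableOn_Ioc_of_le hst.le).1 hφg
  have hJ := hφ.convexOn.map_set_average_le (μ := volume) (t := Ioc s t) hφ.continuousOn
    isClosed_Ici (by simp [hst]) (by simp) (.of_forall fun u => abs_nonneg (g u / r)) hg' hφg'
  rw [setAverage_eq, setAverage_eq, Real.volume_real_Ioc_of_le hst.le, smul_eq_mul, smul_eq_mul,
    ← intervalIntegral.integral_of_le hst.le, ← intervalIntegral.integral_of_le hst.le] at hJ
  have hle : |∫ u in s..t, g u| / (r * (t - s)) ≤ (t - s)⁻¹ * ∫ u in s..t, |g u / r| := by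
    have h1 : |∫ u in s..t, g u| ≤ ∫ u in s..t, |g u| :=
      intervalIntegral.abs_integral_le_integral_abs hst.le
    have h2 : ∫ u in s..t, |g u / r| = (∫ u in s..t, |g u|) / r := by
      rw [← intervalIntegral.integral_div]
      simp only [abs_div, abs_of_pos hr]
    rw [h2, ← div_eq_inv_mul, div_div]
    gcongr
  have h0 : 0 ≤ |∫ u in s..t, g u| / (r * (t - s)) := by positivity
  have hmono := (hφ.monotoneOn h0 (h0.trans hle) hle).trans hJ
  rwa [← div_eq_inv_mul, le_div_iff₀ hts] at hmono

/-- An indefinite integral of a function in `L^φ` belongs to `GV_φ`. -/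
theorem MemOrlicz.memGV_of_eq_integral {φ : ℝ → ℝ} (hφ : IsConvexPhiFunction φ)
    (hO : OrliczCondition φ) {a b c : ℝ} {g x : ℝ → ℝ} (hg : MemOrlicz φ a b g)
    (hx : ∀ t ∈ Icc a b, x t = c + ∫ s in a..t, g s) : MemGV φ a b x := by
  have hgi := hg.integrableOn hO hφ.toIsPhiFunction
  obtain ⟨hm, r, hr, hfin⟩ := hg
  have hφi := integrableOn_of_orliczModular_lt_top hφ.toIsPhiFunction (hm.div_const r) hfin
  -- The scale `r` that works for `g` also works for its primitive, since the Jensen bounds add up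
  -- over adjacent intervals.
  refine ⟨r, hr, lt_of_le_of_lt ?_ (ENNReal.ofReal_lt_top (r := ∫ u in a..b, φ |g u / r|))⟩
  refine iSup_le fun m => iSup_le fun t => iSup_le fun ⟨h0, hm, hlt⟩ => ?_
  have hmono : ∀ i j, i ≤ j → j ≤ m → t i ≤ t j := by
    intro i j hij
    induction j, hij using Nat.le_induction with
    | base => intro _; exact le_rfl
    | succ k _ ih => intro hk; exact (ih (by omega)).trans (hlt k (by omega)).le
  have hmem : ∀ i ≤ m, t i ∈ Icc a b := fun i hi =>
    ⟨h0 ▸ hmono 0 i (Nat.zero_le i) hi, hm ▸ hmono i m hi le_rfl⟩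
  have hii : ∀ {F : ℝ → ℝ}, IntegrableOn F (Icc a b) → ∀ {u v : ℝ}, u ∈ Icc a b → v ∈ Icc a b →
      IntervalIntegrable F volume u v := fun hF u v hu hv =>
    (hF.mono_set (uIcc_subset_Icc hu hv)).intervalIntegrable
  have ha : a ∈ Icc a b := h0 ▸ hmem 0 (Nat.zero_le m)
  have hterm : ∀ i ∈ Finset.range m,
      φ (|(x (t (i + 1)) + (0 : ℝ → ℝ) (t i)) - (x (t i) + (0 : ℝ → ℝ) (t (i + 1)))| /
        (r * (t (i + 1) - t i))) * (t (i + 1) - t i) ≤ ∫ u in t i..t (i + 1), φ |g u / r| := by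
    intro i hi
    have him := Finset.mem_range.1 hi
    have hi0 := hmem i him.le
    have hi1 := hmem (i + 1) him
    have hinc : (x (t (i + 1)) + (0 : ℝ → ℝ) (t i)) - (x (t i) + (0 : ℝ → ℝ) (t (i + 1))) =
        ∫ u in t i..t (i + 1), g u := by
      rw [hx _ hi0, hx _ hi1, ← intervalIntegral.integral_interval_sub_left (hii hgi ha hi1)
        (hii hgi ha hi0)]
      simp
    rw [hinc]
    exact hφ.map_abs_integral_div_mul_le hr (hlt i him) (hii hgi hi0 hi1) (hii hφi hi0 hi1)
  have hnonneg : ∀ i ∈ Finset.range m,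
      0 ≤ φ (|(x (t (i + 1)) + (0 : ℝ → ℝ) (t i)) - (x (t i) + (0 : ℝ → ℝ) (t (i + 1)))| /
        (r * (t (i + 1) - t i))) * (t (i + 1) - t i) := by
    intro i hi
    have hd : 0 < t (i + 1) - t i := sub_pos.2 (hlt i (Finset.mem_range.1 hi))
    exact mul_nonneg (hφ.mapsTo (div_nonneg (abs_nonneg _) (mul_pos hr hd).le)) hd.le
  rw [← ENNReal.ofReal_sum_of_nonneg hnonneg]
  refine ENNReal.ofReal_le_ofReal ((Finset.sum_le_sum hterm).trans_eq ?_)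
  rw [intervalIntegral.sum_integral_adjacent_intervals fun k hk =>
    hii hφi (hmem k hk.le) (hmem (k + 1) hk), h0, hm]

/-- Superposition of a Lipschitz Carathéodory function, integrable at one state, with a bounded
measurable function is integrable. -/
theorem integrableOn_superposition {s : Set ℝ} (hs : volume s ≠ ∞) {f : ℝ → ℝ → ℝ} {L y₀ M : ℝ}
    (hmeas : ∀ x, AEMeasurable (fun t => f t x) (volume.restrict s))
    (hint : IntegrableOn (fun t => f t y₀) s) (hL : 0 < L)
    (hLip : ∀ᵐ t ∂(volume.restrict s), ∀ x y : ℝ, |f t x - f t y| ≤ L * |x - y|)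
    {g : ℝ → ℝ} (hg : Measurable g) (hM : ∀ t, |g t - y₀| ≤ M) :
    AEMeasurable (fun t => f t (g t)) (volume.restrict s) ∧
      (∀ᵐ t ∂(volume.restrict s), |f t (g t)| ≤ |f t y₀| + L * M) ∧
      IntegrableOn (fun t => f t (g t)) s := by
  have hcont : ∀ᵐ t ∂(volume.restrict s), Continuous (f t) := by
    filter_upwards [hLip] with t ht
    exact (LipschitzWith.of_dist_le_mul (K := ⟨L, hL.le⟩) fun x y => ht x y).continuous
  have hm := aemeasurable_superposition hmeas hcont hg
  have hle : ∀ᵐ t ∂(volume.restrict s), |f t (g t)| ≤ |f t y₀| + L * M := by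
    filter_upwards [hLip] with t ht
    have h1 := ht (g t) y₀
    have h2 := mul_le_mul_of_nonneg_left (hM t) hL.le
    have h3 := abs_sub_abs_le_abs_sub (f t (g t)) (f t y₀)
    linarith
  exact ⟨hm, hle, (hint.abs.add (integrableOn_const hs)).mono' hm.aestronglyMeasurable hle⟩

/-- Picard's theorem for Lipschitz Carathéodory right-hand sides on a short interval, in integral
form. -/
theorem exists_eq_add_integral {a b : ℝ} (hab : a ≤ b) {f : ℝ → ℝ → ℝ} {L y₀ : ℝ}
    (hmeas : ∀ x, AEMeasurable (fun t => f t x) (volume.restrict (Icc a b)))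
    (hint : IntegrableOn (fun t => f t y₀) (Icc a b)) (hL : 0 < L)
    (hLip : ∀ᵐ t ∂(volume.restrict (Icc a b)), ∀ x y : ℝ, |f t x - f t y| ≤ L * |x - y|)
    (hLab : L * (b - a) < 1) (x₀ : ℝ) :
    ∃ x : ℝ → ℝ, Continuous x ∧ (∃ M, ∀ t, |x t - y₀| ≤ M) ∧
      ∀ t ∈ Icc a b, x t = x₀ + ∫ s in a..t, f s (x s) := by
  have hbdd : ∀ x : C(Icc a b, ℝ), ∀ t, |IccExtend hab x t - y₀| ≤ ‖x‖ + |y₀| := fun x t =>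
    (abs_sub _ _).trans (add_le_add_left (x.norm_coe_le_norm (projIcc a b hab t)) _)
  have hcontExt : ∀ x : C(Icc a b, ℝ), Continuous (IccExtend hab x) := fun x =>
    x.continuous.Icc_extend'
  have hi : ∀ x : C(Icc a b, ℝ), IntegrableOn (fun t => f t (IccExtend hab x t)) (Icc a b) :=
    fun x => (integrableOn_superposition (by simp) hmeas hint hL hLip (hcontExt x).measurable
      (hbdd x)).2.2
  have hii : ∀ x : C(Icc a b, ℝ), ∀ t ∈ Icc a b,
      IntervalIntegrable (fun t => f t (IccExtend hab x t)) volume a t := fun x t ht =>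
    ((hi x).mono_set (uIcc_subset_Icc (left_mem_Icc.2 hab) ht)).intervalIntegrable
  have hc : ∀ x : C(Icc a b, ℝ),
      ContinuousOn (fun t => x₀ + ∫ s in a..t, f s (IccExtend hab x s)) (Icc a b) := fun x =>
    continuousOn_const.add
      (intervalIntegral.continuousOn_primitive_interval (by rw [uIcc_of_le hab]; exact hi x)
        |>.mono (by rw [uIcc_of_le hab]))
  -- The Picard operator; `IccExtend` prolongs `x` by its endpoint values so that it can be
  -- integrated along ℝ.
  let T : C(Icc a b, ℝ) → C(Icc a b, ℝ) := fun x =>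
    ⟨(Icc a b).domRestrict fun t => x₀ + ∫ s in a..t, f s (IccExtend hab x s), (hc x).domRestrict⟩
  have hK0 : 0 ≤ L * (b - a) := mul_nonneg hL.le (sub_nonneg.2 hab)
  have hT : ContractingWith ⟨L * (b - a), hK0⟩ T := by
    refine ⟨by exact_mod_cast hLab, LipschitzWith.of_dist_le_mul fun x y => ?_⟩
    refine (ContinuousMap.dist_le (mul_nonneg hK0 dist_nonneg)).2 fun t => ?_
    have hsub : T x t - T y t =
        ∫ s in a..t, (f s (IccExtend hab x s) - f s (IccExtend hab y s)) := by
      rw [intervalIntegral.integral_sub (hii x t t.2) (hii y t t.2)]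
      exact add_sub_add_left_eq_sub _ _ _
    have hbound : ‖∫ s in a..t, (f s (IccExtend hab x s) - f s (IccExtend hab y s))‖ ≤
        L * dist x y * |(t : ℝ) - a| := by
      refine intervalIntegral.norm_integral_le_of_norm_le_const_ae ?_
      filter_upwards [(ae_restrict_iff' measurableSet_Icc).1 hLip] with s hs hst
      rw [uIoc_of_le t.2.1] at hst
      refine (hs ⟨hst.1.le, hst.2.trans t.2.2⟩ _ _).trans ?_
      exact mul_le_mul_of_nonneg_left
        (ContinuousMap.dist_apply_le_dist (f := x) (g := y) (projIcc a b hab s)) hL.le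
    rw [Real.dist_eq, hsub]
    refine hbound.trans ?_
    rw [abs_of_nonneg (sub_nonneg.2 t.2.1)]
    have : (t : ℝ) - a ≤ b - a := sub_le_sub_right t.2.2 a
    calc L * dist x y * ((t : ℝ) - a) ≤ L * dist x y * (b - a) := by gcongr
      _ = L * (b - a) * dist x y := by ring
  have : Nonempty C(Icc a b, ℝ) := ⟨0⟩
  have hfix : T (hT.fixedPoint T) = hT.fixedPoint T := hT.fixedPoint_isFixedPt
  set x := hT.fixedPoint T
  refine ⟨IccExtend hab x, hcontExt x, ⟨_, hbdd x⟩, fun t ht => ?_⟩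
  rw [IccExtend_of_mem hab _ ht]
  exact (congrArg (fun y : C(Icc a b, ℝ) => y ⟨t, ht⟩) hfix).symm

end GenVariation

theorem theorem6p2
    (φ : ℝ → ℝ) (hφ : GenVariation.IsConvexPhiFunction φ)
    (hOrlicz : GenVariation.OrliczCondition φ)
    (a b : ℝ) (hab : a < b) (f : ℝ → ℝ → ℝ)
    (hmeas : ∀ x : ℝ, AEMeasurable (fun t => f t x) (volume.restrict (Icc a b)))
    (hL : ∃ y₀ : ℝ, GenVariation.MemOrlicz φ a b (fun t => f t y₀))
    (L : ℝ) (hLpos : 0 < L)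
    (hLip : ∀ᵐ t ∂(volume.restrict (Icc a b)), ∀ x y : ℝ, |f t x - f t y| ≤ L * |x - y|)
    (x₀ : ℝ) (b₁ : ℝ) (hab₁ : a < b₁) (hb₁b : b₁ ≤ b) (hLb₁ : L * (b₁ - a) < 1) :
    ∃ x : ℝ → ℝ, GenVariation.MemGV φ a b₁ x ∧ x a = x₀ ∧
      ∀ᵐ t ∂(volume.restrict (Icc a b₁)), HasDerivWithinAt x (f t (x t)) (Icc a b₁) t := by
  obtain ⟨y₀, hy₀⟩ := hL
  have hsub : Icc a b₁ ⊆ Icc a b := Icc_subset_Icc_right hb₁b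
  have hmeas₁ : ∀ x, AEMeasurable (fun t => f t x) (volume.restrict (Icc a b₁)) :=
    fun x => (hmeas x).mono_set hsub
  have hLip₁ := ae_restrict_of_ae_restrict_of_subset hsub hLip
  have hy₁ := hy₀.mono_right hb₁b
  have hint := hy₁.integrableOn hOrlicz hφ.toIsPhiFunction
  obtain ⟨x, hxc, ⟨M, hM⟩, hx⟩ :=
    GenVariation.exists_eq_add_integral hab₁.le hmeas₁ hint hLpos hLip₁ hLb₁ x₀
  obtain ⟨hm, hle, hi⟩ := GenVariation.integrableOn_superposition (by simp) hmeas₁ hint hLpos hLip₁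
    hxc.measurable hM
  refine ⟨x, (hy₁.of_abs_le_add hφ.toIsPhiFunction hm hle).memGV_of_eq_integral hφ hOrlicz hx,
    by simpa using hx a (left_mem_Icc.2 hab₁.le), ?_⟩
  have hii : IntervalIntegrable (fun t => f t (x t)) volume a b₁ :=
    (intervalIntegrable_iff_integrableOn_Icc_of_le hab₁.le).2 hi
  rw [ae_restrict_iff' measurableSet_Icc]
  -- Lebesgue differentiation; the one-sided set `Icc a b₁` is needed because `x` equals the
  -- primitive only there.
  filter_upwards [hii.ae_hasDerivAt_integral] with t ht htm
  rw [uIcc_of_le hab₁.le] at ht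
  exact ((ht htm a (left_mem_Icc.2 hab₁.le)).const_add x₀).hasDerivWithinAt.congr hx (hx t htm)
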